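/- Let $p_1, p_2$ be odd primes such that, for $\{i,j\}=\{1,2\}$, the multiplicative order of $2$ modulo $p_i$ does not divide $p_j-1$, and let $n=p_1p_2$. Let $E$ be a finite set with $|E|=n$, equipped with the rank function $\mathrm{rk}\colon 2^E\to\mathbf{Z}$ given by $\mathrm{rk}(\varnothing)=0$, $\mathrm{rk}(E)=n$, and $\mathrm{rk}(A)=1$ for $\varnothing\subsetneq A\subsetneq E$, and let \[ T_n(x,y)=\sum_{A\subseteq E}(x-1)^{\mathrm{rk}(E)-\mathrm{rk}(A)}(y-1)^{|A|-\mathrm{rk}(A)}\in\mathbf{Z}[x,y] \] be its corank-nullity (Tutte) polynomial. Then, with $X=x-1$, the specialization of $T_n$ at $y=2$ is \[ X^n+(2^n-2)X^{n-1}+1, \] and the Galois group of the splitting field of this polynomial over $\mathbf{Q}$ is isomorphic to the symmetric group $\mathfrak{S}_n$. Moreover the Galois group of the splitting field over $\mathbf{Q}(y)$ of $T_n(x,y)$, seen as a polynomial in $x$, is isomorphic to $\mathfrak{S}_n$. -/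

import Mathlib

open Polynomial

/-- A ranked set with groundset `E`: an integer-valued rank function on the subsets of the finite
set `E` with `rk ∅ = 0`, `rk A ≤ rk E` and `rk A ≤ |A|` for every `A ⊆ E`. -/
structure RankedSet (E : Type*) [Fintype E] where
  rk : Finset E → ℤ
  rk_empty : rk ∅ = 0
  rk_le_rk_univ : ∀ A, rk A ≤ rk Finset.univ
  rk_le_card : ∀ A, rk A ≤ (A.card : ℤ)

/-- The corank-nullity polynomial
`T_S(x, y) = ∑_{A ⊆ E} (x - 1) ^ (rk E - rk A) * (y - 1) ^ (|A| - rk A)`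
as a polynomial in `x` (the outer variable) over `ℤ[y]` (`y` is the inner variable).
Both exponents are non-negative by the axioms of a ranked set, so `Int.toNat` loses nothing. -/
noncomputable def RankedSet.corankNullity {E : Type*} [Fintype E] (S : RankedSet E) : ℤ[X][X] :=
  ∑ A : Finset E,
    (X - 1) ^ (S.rk Finset.univ - S.rk A).toNat * C ((X - 1) ^ ((A.card : ℤ) - S.rk A).toNat)

/-- The Galois group `G_{k,y}(T)` of `T(x, y) ∈ ℤ[x, y]`, seen as a polynomial in `x`: the Galois
group over the rational function field `k(y)` of the splitting field of `T`. -/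
abbrev galoisGroupOver (k : Type*) [Field k] (T : ℤ[X][X]) : Type _ :=
  (T.map ((algebraMap k[X] (RatFunc k)).comp (mapRingHom (Int.castRingHom k)))).Gal

/-- The ranked set on `E` whose rank function is `0` on the empty set, `|E|` on `E`, and `1` on every
non-empty proper subset. -/
def threeValuedRankedSet (E : Type*) [Fintype E] [DecidableEq E] : RankedSet E where
  rk A := if A = ∅ then 0 else if A = Finset.univ then (Fintype.card E : ℤ) else 1
  rk_empty := by simp
  rk_le_rk_univ A := by
    rcases isEmpty_or_nonempty E with h | h
    · rw [Subsingleton.elim A Finset.univ]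
    · have h1 : 0 < Fintype.card E := Fintype.card_pos
      have h2 : (Finset.univ : Finset E) ≠ ∅ := Finset.univ_nonempty.ne_empty
      rw [if_neg h2, if_pos rfl]
      split_ifs <;> omega
  rk_le_card A := by
    split_ifs with h1 h2
    · simp
    · simp [h2]
    · have := Finset.card_pos.mpr (Finset.nonempty_iff_ne_empty.mpr h1)
      omega

/-! Put a = 2^n - 2. Fermat's little theorem and the hypothesis on orders make n and a coprime
(`not_dvd_two_pow_mul_sub_two`). As |a| > n, Perron's criterion (`irreducible_trinomial`) makes f =
X^n + a X^(n-1) + 1 irreducible, so its Galois group is transitive on the roots. By Minkowski, ℚ has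
no proper extension unramified at all finite primes, so inertia groups generate the Galois group
(`NumberField.iSup_inertia_eq_top`). Modulo any prime, n and a do not both vanish, so at most two
roots of f collide (`natDegree_le_card_roots_trinomial`), and an inertia element is trivial or a
transposition. A transitive group generated by transpositions is the full symmetric group.

Specializing y = 2 cannot enlarge the Galois group (`Polynomial.Gal.card_map_le_card_map`), so the
group over ℚ(y) also has order at least n!, while it embeds in 𝔖_n. -/

open NumberField

/-! ### Galois groups, permutations and specialization -/

/-- A monic polynomial that splits in a field extension splits in the integral closure. -/
theorem Polynomial.Monic.splits_map_of_isIntegralClosure {A B L : Type*} [CommRing A] [CommRing B]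
    [Field L] [Algebra A B] [Algebra B L] [Algebra A L] [IsScalarTower A B L]
    [IsIntegralClosure B A L] {F : A[X]} (hF : F.Monic) (h : (F.map (algebraMap A L)).Splits) :
    (F.map (algebraMap A B)).Splits := by
  rw [IsScalarTower.algebraMap_eq A B L, ← Polynomial.map_map] at h
  refine h.of_splits_map_of_injective (IsIntegralClosure.algebraMap_injective B A L) fun a ha ↦ ?_
  rw [Polynomial.map_map, ← IsScalarTower.algebraMap_eq] at ha
  have ha' : IsIntegral A a := ⟨F, hF, by simpa [eval_map] using (isRoot_of_mem_roots ha)⟩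
  exact ⟨IsIntegralClosure.mk' B a ha', IsIntegralClosure.algebraMap_mk' B a ha'⟩

/-- The group acts faithfully on at most n roots, so it embeds in a group of order n!. Only lower
bounds on its order remain to be proved. -/
theorem Polynomial.Gal.nonempty_mulEquiv_perm_of_factorial_le {F : Type*} [Field F] {p : F[X]}
    {n : ℕ} (hp : p.natDegree ≤ n) (h : n.factorial ≤ Nat.card p.Gal) :
    Nonempty (p.Gal ≃* Equiv.Perm (Fin n)) := by
  classical
  have : Fact ((p.map (algebraMap F p.SplittingField)).Splits) := ⟨SplittingField.splits p⟩
  have hcard : Fintype.card (p.rootSet p.SplittingField) ≤ Fintype.card (Fin n) := by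
    rw [Fintype.card_fin, ← Nat.card_eq_fintype_card]
    exact (ncard_rootSet_le p p.SplittingField).trans hp
  obtain ⟨ι⟩ := Function.Embedding.nonempty_of_card_le hcard
  let φ : p.Gal →* Equiv.Perm (Fin n) :=
    (Equiv.Perm.viaEmbeddingHom ι).comp (Gal.galActionHom p p.SplittingField)
  have hφ : Function.Injective φ :=
    (Equiv.Perm.viaEmbeddingHom_injective ι).comp (Gal.galActionHom_injective p p.SplittingField)
  refine ⟨MulEquiv.ofBijective φ ((Nat.bijective_iff_injective_and_card φ).2 ⟨hφ, ?_⟩)⟩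
  refine le_antisymm (Nat.card_le_card_of_injective φ hφ) ?_
  rwa [Nat.card_perm, Nat.card_fin]

attribute [local instance] Ideal.Quotient.field in
/-- The Galois group of a specialization of a monic polynomial is at most as large as the Galois
group of the polynomial. -/
theorem Polynomial.Gal.card_map_le_card_map {A K k : Type*} [CommRing A] [IsDomain A]
    [IsIntegrallyClosed A] [Field K] [PerfectField K] [Algebra A K] [IsFractionRing A K] [Field k]
    {φ : A →+* k} (hφ : Function.Surjective φ) {F : A[X]} (hF : F.Monic) :
    Nat.card (F.map φ).Gal ≤ Nat.card (F.map (algebraMap A K)).Gal := by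
  let L := (F.map (algebraMap A K)).SplittingField
  have : IsGalois K L := {}
  let B := integralClosure A L
  let G := Gal(L/K)
  have : IsFractionRing B L := integralClosure.isFractionRing_of_finite_extension K L
  have hG : IsGaloisGroup G A B := IsGaloisGroup.of_isFractionRing G A B K L
  let P := RingHom.ker φ
  have : P.IsMaximal := RingHom.ker_isMaximal_of_surjective φ hφ
  have : FaithfulSMul A L := (faithfulSMul_iff_algebraMap_injective A L).2 <| by
    rw [IsScalarTower.algebraMap_eq A K L]
    exact (algebraMap K L).injective.comp (IsFractionRing.injective A K)
  have : FaithfulSMul A B := FaithfulSMul.tower_bot A B L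
  obtain ⟨Q, _, _⟩ := Ideal.exists_maximal_ideal_liesOver_of_isIntegral (S := B) P
  let e : A ⧸ P ≃+* k := RingHom.quotientKerEquivOfSurjective hφ
  let : Algebra (A ⧸ P) k := e.toRingHom.toAlgebra
  have : IsFractionRing (A ⧸ P) k := IsFractionRing.of_ringEquiv_left e fun _ ↦ rfl
  let : Algebra k (B ⧸ Q) := ((algebraMap (A ⧸ P) (B ⧸ Q)).comp e.symm.toRingHom).toAlgebra
  have : IsScalarTower (A ⧸ P) k (B ⧸ Q) := .of_algebraMap_eq fun x ↦
    (congrArg (algebraMap (A ⧸ P) (B ⧸ Q)) (e.symm_apply_apply x)).symm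
  have : Normal k (B ⧸ Q) := Ideal.IsFractionRing.normal G P Q k (B ⧸ Q)
  have hsplit : ((F.map φ).map (algebraMap k (B ⧸ Q))).Splits := by
    have h1 : (F.map (algebraMap A B)).Splits := hF.splits_map_of_isIntegralClosure (L := L) <| by
      rw [IsScalarTower.algebraMap_eq A K L, ← Polynomial.map_map]
      exact SplittingField.splits _
    have h2 := h1.map (algebraMap B (B ⧸ Q))
    have h3 : (algebraMap k (B ⧸ Q)).comp φ = (algebraMap B (B ⧸ Q)).comp (algebraMap A B) :=
      RingHom.ext fun a ↦ (IsScalarTower.algebraMap_apply (A ⧸ P) k (B ⧸ Q) (algebraMap A _ a)).symm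
    rwa [Polynomial.map_map, ← h3, ← Polynomial.map_map] at h2
  have : Fact ((F.map φ).map (algebraMap k (B ⧸ Q))).Splits := ⟨hsplit⟩
  -- The decomposition group of Q surjects onto the automorphisms of the residue extension, which
  -- contains a splitting field of the specialized polynomial.
  have hsurj : Function.Surjective ((Gal.restrict (F.map φ) (B ⧸ Q)).comp
      (IsFractionRing.stabilizerHom G P Q k (B ⧸ Q))) :=
    (Gal.restrict_surjective (F.map φ) (B ⧸ Q)).comp
      (IsFractionRing.stabilizerHom_surjective G P Q k (B ⧸ Q))
  exact (Nat.card_le_card_of_surjective _ hsurj).trans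
    (Nat.card_le_card_of_injective _ (Subgroup.subtype_injective _))

/-! ### Generation by inertia -/

/-- The Galois group of a number field is generated by its inertia subgroups. -/
theorem NumberField.iSup_inertia_eq_top (L : Type*) [Field L] [NumberField L] [IsGalois ℚ L] :
    ⨆ m : MaximalSpectrum (𝓞 L), m.asIdeal.inertia Gal(L/ℚ) = ⊤ := by
  set H := ⨆ m : MaximalSpectrum (𝓞 L), m.asIdeal.inertia Gal(L/ℚ) with hH
  let K : IntermediateField ℚ L := FixedPoints.intermediateField H
  have : IsGaloisGroup H K L := IsGaloisGroup.subgroup Gal(L/ℚ) ℚ L H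
  have : IsGaloisGroup H (𝓞 K) (𝓞 L) := IsGaloisGroup.of_isFractionRing H (𝓞 K) (𝓞 L) K L
  have : IsGaloisGroup Gal(L/ℚ) ℤ (𝓞 L) := IsGaloisGroup.of_isFractionRing _ ℤ (𝓞 L) ℚ L
  have hK : Module.finrank ℚ K = 1 := by
    -- Minkowski: were the fixed field K larger than ℚ, some prime P of K would ramify.
    by_contra hK
    obtain ⟨P, _, hP⟩ := exists_not_isUnramifiedAt_int (𝒪 := 𝓞 K) hK
    refine hP (Ideal.ramificationIdx_eq_one_iff.1 ?_)
    obtain ⟨Q, _, _⟩ := Ideal.exists_maximal_ideal_liesOver_of_isIntegral (S := 𝓞 L) P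
    have h1 := Ideal.ramificationIdx_tower (R := ℤ) P Q
    rw [← Ideal.ramificationIdxIn_eq_ramificationIdx (Q.under ℤ) Q Gal(L/ℚ),
      ← Ideal.ramificationIdxIn_eq_ramificationIdx P Q H,
      ← Ideal.card_inertia_eq_ramificationIdxIn (G := Gal(L/ℚ)) (Q.under ℤ) Q,
      ← Ideal.card_inertia_eq_ramificationIdxIn (G := H) P Q] at h1
    -- All inertia at Q lies in H, so Q has the same ramification index over K as over ℚ, and P has
    -- index 1.
    have hle : Q.inertia Gal(L/ℚ) ≤ H := le_iSup (fun m : MaximalSpectrum (𝓞 L) ↦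
      m.asIdeal.inertia Gal(L/ℚ)) ⟨Q, inferInstance⟩
    have h2 : Nat.card (Q.inertia H) = Nat.card (Q.inertia Gal(L/ℚ)) :=
      Nat.card_congr (Subgroup.subgroupOfEquivOfLe hle).toEquiv
    rw [h2] at h1
    exact (right_eq_mul₀ Nat.card_pos.ne').1 h1
  have h1 := Module.finrank_mul_finrank ℚ K L
  rw [hK, one_mul, ← IsGaloisGroup.card_eq_finrank H K L,
    ← IsGaloisGroup.card_eq_finrank Gal(L/ℚ) ℚ L] at h1
  exact Subgroup.eq_top_of_card_eq H h1

/-! ### Counting repetitions and bounding roots -/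

theorem Multiset.card_le_card_toFinset_add_one {α : Type*} [DecidableEq α] {s : Multiset α}
    (h2 : ∀ x, s.count x ≤ 2) (h1 : ∀ x y, 1 < s.count x → 1 < s.count y → x = y) :
    s.card ≤ s.toFinset.card + 1 := by
  rw [← Multiset.toFinset_sum_count_eq]
  by_cases h : ∃ c, 1 < s.count c
  · obtain ⟨c, hc⟩ := h
    calc ∑ x ∈ s.toFinset, s.count x ≤ ∑ x ∈ s.toFinset, (1 + if x = c then 1 else 0) := by
          refine Finset.sum_le_sum fun x _ ↦ ?_
          split_ifs with hx
          · exact h2 x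
          · exact not_lt.1 fun hlt ↦ hx (h1 x c hlt hc)
      _ ≤ s.toFinset.card + 1 := by
          rw [Finset.sum_add_distrib, Finset.sum_ite_eq']
          simp only [Finset.sum_const, smul_eq_mul, mul_one]
          split_ifs <;> omega
  · push Not at h
    calc ∑ x ∈ s.toFinset, s.count x ≤ ∑ _x ∈ s.toFinset, 1 := Finset.sum_le_sum fun x _ ↦ h x
      _ ≤ s.toFinset.card + 1 := by simp

theorem Multiset.norm_prod_lt_one {s : Multiset ℂ} (hs : s ≠ 0) (h : ∀ z ∈ s, ‖z‖ < 1) :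
    ‖s.prod‖ < 1 := by
  induction s using Multiset.induction_on with
  | empty => exact absurd rfl hs
  | cons a s ih =>
    rw [Multiset.prod_cons, norm_mul]
    have ha := h a (Multiset.mem_cons_self a s)
    rcases eq_or_ne s 0 with rfl | hs'
    · simpa using ha
    · have := ih hs' fun z hz ↦ h z (Multiset.mem_cons_of_mem hz)
      nlinarith [norm_nonneg a, norm_nonneg s.prod]

/-- A monic integer polynomial with constant coefficient `±1` has a root of modulus at least `1`. -/
theorem Polynomial.Monic.exists_root_one_le_norm {g : ℤ[X]} (hg : g.Monic) (hd : g.natDegree ≠ 0)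
    (h0 : IsUnit (g.coeff 0)) : ∃ z : ℂ, 1 ≤ ‖z‖ ∧ aeval z g = 0 := by
  by_contra! h
  have hm : (g.map (algebraMap ℤ ℂ)).Monic := hg.map _
  have hs : (g.map (algebraMap ℤ ℂ)).Splits := IsAlgClosed.splits _
  have hc := hs.coeff_zero_eq_prod_roots_of_monic hm
  have hr : (g.map (algebraMap ℤ ℂ)).roots ≠ 0 :=
    hs.roots_ne_zero (by rwa [hg.natDegree_map])
  have hlt := Multiset.norm_prod_lt_one hr fun z hz ↦ by
    by_contra! hz1
    refine h z hz1 ?_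
    rw [← eval_map_algebraMap]
    exact isRoot_of_mem_roots hz
  have := congrArg norm hc
  rw [norm_mul, norm_pow, norm_neg, norm_one, one_pow, one_mul, coeff_map] at this
  rw [← this] at hlt
  rcases Int.isUnit_iff.1 h0 with h0 | h0 <;> simp [h0] at hlt

/-! ### Repeated roots of trinomials -/

section Trinomial

variable {R : Type*} [CommRing R]

theorem degree_C_mul_X_pow_add_one_lt [Nontrivial R] {n : ℕ} (hn : 2 ≤ n) (a : R) :
    (C a * X ^ (n - 1) + 1 : R[X]).degree < n := by
  refine (degree_add_le _ _).trans_lt (max_lt ?_ ?_)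
  · exact (degree_C_mul_X_pow_le _ _).trans_lt (by exact_mod_cast (by lia : n - 1 < n))
  · rw [degree_one]
    exact_mod_cast (by lia : 0 < n)

theorem monic_X_pow_add_C_mul_X_pow_add_one {n : ℕ} (hn : 2 ≤ n) (a : R) :
    (X ^ n + C a * X ^ (n - 1) + 1 : R[X]).Monic := by
  nontriviality R
  rw [add_assoc]
  exact monic_X_pow_add (degree_C_mul_X_pow_add_one_lt hn a)

theorem natDegree_X_pow_add_C_mul_X_pow_add_one [Nontrivial R] {n : ℕ} (hn : 2 ≤ n) (a : R) :
    (X ^ n + C a * X ^ (n - 1) + 1 : R[X]).natDegree = n := by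
  refine natDegree_eq_of_degree_eq_some ?_
  rw [add_assoc, degree_add_eq_left_of_degree_lt, degree_X_pow]
  rw [degree_X_pow]
  exact degree_C_mul_X_pow_add_one_lt hn a

/-- The derivative is X^(m+1) ((m+3) X + (m+2) a), and 0 is not a root. -/
theorem one_lt_rootMultiplicity_trinomial [IsDomain R] {m : ℕ} {a x : R}
    (h : 1 < (X ^ (m + 3) + C a * X ^ (m + 2) + 1 : R[X]).rootMultiplicity x) :
    x ≠ 0 ∧ (m + 3) * x + (m + 2) * a = 0 := by
  have hf : (X ^ (m + 3) + C a * X ^ (m + 2) + 1 : R[X]) ≠ 0 :=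
    (monic_X_pow_add_C_mul_X_pow_add_one (by lia) a).ne_zero
  obtain ⟨h0, h1⟩ := (one_lt_rootMultiplicity_iff_isRoot hf).1 h
  have hx : x ≠ 0 := by
    rintro rfl
    simp at h0
  refine ⟨hx, ?_⟩
  simp at h1
  refine (mul_eq_zero.1 (?_ : x ^ (m + 1) * _ = 0)).resolve_left (pow_ne_zero _ hx)
  linear_combination h1

theorem rootMultiplicity_trinomial_le_two [IsDomain R] {m : ℕ} {a : R}
    (h : (m + 3 : R) ≠ 0 ∨ a ≠ 0) (x : R) :
    (X ^ (m + 3) + C a * X ^ (m + 2) + 1 : R[X]).rootMultiplicity x ≤ 2 := by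
  by_contra! h2
  obtain ⟨hx, h1⟩ := one_lt_rootMultiplicity_trinomial (one_lt_two.trans h2)
  have h3 := isRoot_iterate_derivative_of_lt_rootMultiplicity h2
  simp at h3
  -- Eliminating x between the first two derivatives avoids division, so every characteristic is
  -- covered.
  have h4 : (m + 2 : R) * a = 0 := by
    refine (mul_eq_zero.1 (?_ : x ^ (m + 1) * _ = 0)).resolve_left (pow_ne_zero _ hx)
    linear_combination (m + 2) * x ^ (m + 1) * h1 - x * h3
  have h5 : (m + 3 : R) = 0 := by
    refine (mul_eq_zero.1 (?_ : _ * x = 0)).resolve_right hx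
    linear_combination h1 - h4
  refine h.elim (· h5) fun ha ↦ ha ?_
  linear_combination a * h5 - h4

/-- Repeated roots satisfy one linear equation. If its leading coefficient m + 3 vanishes, then m +
2 = -1 and the equation forces a = 0. -/
theorem eq_of_one_lt_rootMultiplicity_trinomial [IsDomain R] {m : ℕ} {a : R}
    (h : (m + 3 : R) ≠ 0 ∨ a ≠ 0) {x y : R}
    (hx : 1 < (X ^ (m + 3) + C a * X ^ (m + 2) + 1 : R[X]).rootMultiplicity x)
    (hy : 1 < (X ^ (m + 3) + C a * X ^ (m + 2) + 1 : R[X]).rootMultiplicity y) : x = y := by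
  have h1 := (one_lt_rootMultiplicity_trinomial hx).2
  have h2 := (one_lt_rootMultiplicity_trinomial hy).2
  have h3 : (m + 3 : R) * (x - y) = 0 := by linear_combination h1 - h2
  rcases mul_eq_zero.1 h3 with h3 | h3
  · refine (h.elim (· h3) fun ha ↦ ha ?_).elim
    linear_combination (a + x) * h3 - h1
  · exact sub_eq_zero.1 h3

/-- If `n` and `a` do not both vanish, the roots of `X ^ n + a X ^ (n - 1) + 1` have at most one
collision. -/
theorem natDegree_le_card_roots_trinomial [IsDomain R] [DecidableEq R] {n : ℕ} (hn : 3 ≤ n) {a : R}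
    (h : (n : R) ≠ 0 ∨ a ≠ 0) (hs : (X ^ n + C a * X ^ (n - 1) + 1 : R[X]).Splits) :
    n ≤ (X ^ n + C a * X ^ (n - 1) + 1 : R[X]).roots.toFinset.card + 1 := by
  have hd := hs.natDegree_eq_card_roots
  rw [natDegree_X_pow_add_C_mul_X_pow_add_one (by lia)] at hd
  obtain ⟨m, rfl⟩ := Nat.exists_eq_add_of_le' hn
  push_cast at h
  conv_lhs => rw [hd]
  refine Multiset.card_le_card_toFinset_add_one (fun x ↦ ?_) fun x y hx hy ↦ ?_
  · rw [count_roots]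
    exact rootMultiplicity_trinomial_le_two h x
  · rw [count_roots] at hx hy
    exact eq_of_one_lt_rootMultiplicity_trinomial h hx hy

end Trinomial

/-! ### Perron's irreducibility criterion -/

/-- The reciprocal trinomial `X ^ n + a X + 1` has at most one root in the closed unit disc. -/
theorem eq_of_trinomial_eq_zero_of_norm_le_one {n : ℕ} {a : ℤ} (ha : (n : ℤ) < |a|) {u v : ℂ}
    (hu : u ^ n + a * u + 1 = 0) (hv : v ^ n + a * v + 1 = 0) (hu1 : ‖u‖ ≤ 1) (hv1 : ‖v‖ ≤ 1) :
    u = v := by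
  by_contra huv
  have h1 := geom_sum₂_mul u v n
  -- Dividing the difference of the two equations by u - v equates -a with a sum of n terms of
  -- modulus at most 1.
  have h2 : ((∑ i ∈ Finset.range n, u ^ i * v ^ (n - 1 - i)) + a) * (u - v) = 0 := by
    linear_combination h1 + hu - hv
  have h3 := (mul_eq_zero.1 h2).resolve_right (sub_ne_zero.2 huv)
  have h4 : ‖∑ i ∈ Finset.range n, u ^ i * v ^ (n - 1 - i)‖ ≤ n := by
    refine (norm_sum_le _ _).trans ?_
    calc _ ≤ ∑ i ∈ Finset.range n, (1 : ℝ) := Finset.sum_le_sum fun i _ ↦ by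
            rw [norm_mul, norm_pow, norm_pow]
            exact mul_le_one₀ (pow_le_one₀ (norm_nonneg _) hu1) (by positivity)
              (pow_le_one₀ (norm_nonneg _) hv1)
      _ = n := by simp
  rw [eq_neg_of_add_eq_zero_left h3, norm_neg, Complex.norm_intCast] at h4
  exact absurd ha (not_lt.2 (by exact_mod_cast h4))

/-- Perron's irreducibility criterion for the trinomial `X ^ n + a X ^ (n - 1) + 1`. -/
theorem irreducible_trinomial {n : ℕ} (hn : 2 ≤ n) {a : ℤ} (ha : (n : ℤ) < |a|) :
    Irreducible (X ^ n + C a * X ^ (n - 1) + 1 : ℤ[X]) := by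
  have hm := monic_X_pow_add_C_mul_X_pow_add_one hn a
  have hd := natDegree_X_pow_add_C_mul_X_pow_add_one hn a
  rw [hm.irreducible_iff_natDegree]
  refine ⟨fun h ↦ ?_, fun g h hg hh hgh ↦ ?_⟩
  · rw [h, natDegree_one] at hd
    lia
  by_contra! hdeg
  have h0 : g.coeff 0 * h.coeff 0 = 1 := by
    rw [← mul_coeff_zero, hgh]
    have h1 : n ≠ 0 := by lia
    have h2 : n - 1 ≠ 0 := by lia
    simp [coeff_X_pow, h1.symm, h2.symm]
  obtain ⟨z, hz1, hz⟩ := hg.exists_root_one_le_norm hdeg.1 (.of_mul_eq_one _ h0)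
  obtain ⟨w, hw1, hw⟩ := hh.exists_root_one_le_norm hdeg.2 (.of_mul_eq_one_right _ h0)
  obtain ⟨m, rfl⟩ := Nat.exists_eq_add_of_le' hn
  have key (x : ℂ) (hx : aeval x g * aeval x h = 0) : x ^ (m + 2) + a * x ^ (m + 1) + 1 = 0 := by
    rw [← map_mul, hgh] at hx
    simpa using hx
  have hz' := key z (by rw [hz, zero_mul])
  have hw' := key w (by rw [hw, mul_zero])
  have hz0 : z ≠ 0 := norm_pos_iff.1 (one_pos.trans_le hz1)
  have hw0 : w ≠ 0 := norm_pos_iff.1 (one_pos.trans_le hw1)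
  have inv (x : ℂ) (hx0 : x ≠ 0) (hx : x ^ (m + 2) + a * x ^ (m + 1) + 1 = 0) :
      x⁻¹ ^ (m + 2) + a * x⁻¹ + 1 = 0 := by
    rw [inv_pow]
    field_simp
    linear_combination x * hx
  -- Inverses of roots outside the open disc solve the reciprocal equation inside the closed one, so
  -- both factors share the root z, a double root.
  obtain rfl : z = w := inv_injective <| eq_of_trinomial_eq_zero_of_norm_le_one ha (inv z hz0 hz')
    (inv w hw0 hw') (by rw [norm_inv]; exact inv_le_one_of_one_le₀ hz1)
    (by rw [norm_inv]; exact inv_le_one_of_one_le₀ hw1)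
  have hder := congrArg (fun p ↦ aeval z (derivative p)) hgh
  simp [derivative_mul, hz, hw] at hder
  have h1 : (m + 2) * z + a * (m + 1) = 0 := by
    refine (mul_eq_zero.1 (?_ : z ^ m * _ = 0)).resolve_left (pow_ne_zero _ hz0)
    linear_combination -hder
  have h2 : ‖z + a‖ ≤ 1 := by
    have h3 : z ^ (m + 1) * (z + a) = -1 := by linear_combination hz'
    have h4 := congrArg norm h3
    rw [norm_mul, norm_pow, norm_neg, norm_one] at h4
    nlinarith [one_le_pow₀ hz1 (n := m + 1), norm_nonneg (z + a)]
  -- With n = m + 2, the derivative gives n (z + a) = a, so |z + a| ≤ 1 contradicts |a| > n.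
  have h3 : ((m + 2 : ℕ) : ℂ) * (z + a) = (a : ℂ) := by
    push_cast
    linear_combination h1
  have h4 := congrArg norm h3
  rw [norm_mul, Complex.norm_natCast, Complex.norm_intCast] at h4
  have h5 : (|a| : ℝ) ≤ (m + 2 : ℕ) := by
    rw [← h4]
    exact mul_le_of_le_one_right (by positivity) h2
  exact absurd ha (not_lt.2 (by exact_mod_cast h5))

/-! ### The Galois group of the trinomial -/

theorem factorial_le_card_gal_of_isSplittingField_trinomial {n : ℕ} (hn : 3 ≤ n) {a : ℤ}
    (ha : (n : ℤ) < |a|) (hcop : IsCoprime (n : ℤ) a) {p : ℚ[X]}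
    (hp : p = X ^ n + C (a : ℚ) * X ^ (n - 1) + 1) (L : Type*) [Field L] [inst : Algebra ℚ L]
    [hL : IsSplittingField ℚ L p] : n.factorial ≤ Nat.card Gal(L/ℚ) := by
  have : CharZero L := charZero_of_injective_algebraMap (algebraMap ℚ L).injective
  -- The ℚ-algebra structure is unique; the given one becomes that of a number field.
  obtain rfl : inst = DivisionRing.toRatAlgebra := Subsingleton.elim _ _
  have : NumberField L := { to_finiteDimensional := IsSplittingField.finiteDimensional L p }
  set f : ℤ[X] := X ^ n + C a * X ^ (n - 1) + 1 with hf
  have hfm : f.Monic := monic_X_pow_add_C_mul_X_pow_add_one (by lia) a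
  have hirr : Irreducible f := irreducible_trinomial (by lia) ha
  have hmap : f.map (algebraMap ℤ ℚ) = p := by rw [hp]; simp [hf]
  have hpirr : Irreducible p := hmap ▸ (hfm.irreducible_iff_irreducible_map_fraction_map).1 hirr
  have : IsGalois ℚ L := IsGalois.of_separable_splitting_field hpirr.separable
  let G := Gal(L/ℚ)
  have hfL : (f.map (algebraMap ℤ L)).Splits := by
    rw [IsScalarTower.algebraMap_eq ℤ ℚ L, ← Polynomial.map_map, hmap]
    exact IsSplittingField.splits L p
  have hS : (f.map (algebraMap ℤ (𝓞 L))).Splits := hfm.splits_map_of_isIntegralClosure hfL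
  have hmin (x : f.rootSet (𝓞 L)) : minpoly ℚ ((x : 𝓞 L) : L) = p := by
    have hx : aeval ((x : 𝓞 L) : L) p = 0 := by
      rw [← hmap, aeval_map_algebraMap, aeval_algebraMap_apply,
        aeval_eq_zero_of_mem_rootSet x.2, map_zero]
    exact (minpoly.eq_of_irreducible_of_monic hpirr hx (hmap ▸ hfm.map _)).symm
  have htrans : MulAction.IsPretransitive G (f.rootSet (𝓞 L)) := by
    refine ⟨fun x y ↦ ?_⟩
    obtain ⟨g, hg⟩ := (Normal.minpoly_eq_iff_mem_orbit L).1 ((hmin y).trans (hmin x).symm)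
    exact ⟨g, Subtype.ext (RingOfIntegers.ext hg)⟩
  have hcard : (f.rootSet (𝓞 L)).ncard = n := by
    classical
    have hd : f.natDegree = n := natDegree_X_pow_add_C_mul_X_pow_add_one (by lia) a
    have hinj := FaithfulSMul.algebraMap_injective (𝓞 L) L
    have hnd : (f.map (algebraMap ℤ (𝓞 L))).roots.Nodup := by
      refine Multiset.Nodup.of_map (algebraMap (𝓞 L) L) ?_
      rw [← hS.roots_map_of_injective hinj, Polynomial.map_map, ← IsScalarTower.algebraMap_eq,
        IsScalarTower.algebraMap_eq ℤ ℚ L, ← Polynomial.map_map, hmap]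
      exact nodup_roots hpirr.separable.map
    rw [rootSet, Set.ncard_coe_finset, aroots, Multiset.toFinset_card_of_nodup hnd,
      ← hS.natDegree_eq_card_roots, hfm.natDegree_map, hd]
  have hcoll (m : MaximalSpectrum (𝓞 L)) :
      (f.rootSet (𝓞 L)).ncard ≤ (f.rootSet (𝓞 L ⧸ m.asIdeal)).ncard + 1 := by
    classical
    have := m.isMaximal
    have hmapq : f.map (algebraMap ℤ (𝓞 L ⧸ m.asIdeal)) =
        X ^ n + C (a : 𝓞 L ⧸ m.asIdeal) * X ^ (n - 1) + 1 := by simp [hf]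
    have hne : ((n : 𝓞 L ⧸ m.asIdeal)) ≠ 0 ∨ (a : 𝓞 L ⧸ m.asIdeal) ≠ 0 := by
      by_contra! h
      obtain ⟨u, v, huv⟩ := hcop
      have := congrArg (Int.cast : ℤ → 𝓞 L ⧸ m.asIdeal) huv
      simp [h.1, h.2] at this
    have hsq := hS.map (algebraMap (𝓞 L) (𝓞 L ⧸ m.asIdeal))
    rw [Polynomial.map_map, ← IsScalarTower.algebraMap_eq, hmapq] at hsq
    rw [hcard, rootSet, Set.ncard_coe_finset, aroots, hmapq]
    exact natDegree_le_card_roots_trinomial hn hne hsq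
  -- Inertia at m fixes roots modulo m, so it moves at most the two colliding roots; transitivity
  -- and generation by inertia then give every permutation.
  have hsurj := hS.surjective_toPermHom_of_iSup_inertia_eq_top (G := G) hcoll
    (NumberField.iSup_inertia_eq_top L)
  have h1 := Nat.card_le_card_of_surjective _ hsurj
  rwa [Nat.card_perm, Nat.card_coe_set_eq, hcard] at h1

theorem factorial_le_card_gal_trinomial {n : ℕ} (hn : 3 ≤ n) {a : ℤ} (ha : (n : ℤ) < |a|)
    (hcop : IsCoprime (n : ℤ) a) :
    n.factorial ≤ Nat.card (X ^ n + C (a : ℚ) * X ^ (n - 1) + 1 : ℚ[X]).Gal :=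
  factorial_le_card_gal_of_isSplittingField_trinomial hn ha hcop rfl _

/-! ### The corank-nullity polynomial and its Galois groups -/

theorem corankNullity_threeValuedRankedSet {E : Type*} [Fintype E] [DecidableEq E]
    (hE : 2 ≤ Fintype.card E) :
    (threeValuedRankedSet E).corankNullity =
      (X - 1) ^ Fintype.card E + C (∑ A ∈ (Finset.univ.erase ∅).erase (Finset.univ : Finset E),
        (X - 1) ^ (A.card - 1)) * (X - 1) ^ (Fintype.card E - 1) + 1 := by
  have : Nonempty E := Fintype.card_pos_iff.1 (by lia)
  have hne : (Finset.univ : Finset E) ≠ ∅ := Finset.univ_nonempty.ne_empty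
  rw [RankedSet.corankNullity, ← Finset.add_sum_erase _ _ (Finset.mem_univ ∅),
    ← Finset.add_sum_erase _ _ (Finset.mem_erase.2 ⟨hne, Finset.mem_univ _⟩)]
  have h1 : ∑ A ∈ (Finset.univ.erase ∅).erase (Finset.univ : Finset E),
      (X - 1 : ℤ[X][X]) ^ ((threeValuedRankedSet E).rk Finset.univ -
          (threeValuedRankedSet E).rk A).toNat *
        C ((X - 1) ^ ((A.card : ℤ) - (threeValuedRankedSet E).rk A).toNat) =
      C (∑ A ∈ (Finset.univ.erase ∅).erase (Finset.univ : Finset E), (X - 1) ^ (A.card - 1)) *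
        (X - 1) ^ (Fintype.card E - 1) := by
    rw [map_sum, Finset.sum_mul]
    refine Finset.sum_congr rfl fun A hA ↦ ?_
    simp only [Finset.mem_erase, Finset.mem_univ, and_true] at hA
    have h2 : (threeValuedRankedSet E).rk A = 1 := by simp [threeValuedRankedSet, hA]
    have h3 : (threeValuedRankedSet E).rk Finset.univ = Fintype.card E := by
      simp [threeValuedRankedSet, hne]
    rw [h2, h3, mul_comm]
    congr 3 <;> lia
  rw [h1]
  simp [threeValuedRankedSet, hne]
  ring

theorem eval_two_sum_proper_nonempty {E : Type*} [Fintype E] [DecidableEq E] [Nonempty E] :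
    (∑ A ∈ (Finset.univ.erase ∅).erase (Finset.univ : Finset E),
      (X - 1 : ℤ[X]) ^ (A.card - 1)).eval 2 = 2 ^ Fintype.card E - 2 := by
  have hne : (Finset.univ : Finset E) ≠ ∅ := Finset.univ_nonempty.ne_empty
  have h2 : 2 ≤ 2 ^ Fintype.card E := Nat.le_self_pow Fintype.card_ne_zero 2
  rw [eval_finsetSum]
  norm_num
  rw [Finset.card_erase_of_mem (by simp [hne]), Finset.card_erase_of_mem (by simp)]
  simp
  lia

/-- Fermat gives 2^(pq) = 2^q modulo p, so divisibility would force 2^(q-1) = 1, as 2 is invertible.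
-/
theorem not_dvd_two_pow_mul_sub_two {p q : ℕ} (hp : p.Prime) (hp2 : Odd p) (hq : q.Prime)
    (h : ¬ orderOf (2 : ZMod p) ∣ q - 1) : ¬ (p : ℤ) ∣ 2 ^ (p * q) - 2 := by
  have := Fact.mk hp
  intro hdvd
  rw [← ZMod.intCast_zmod_eq_zero_iff_dvd] at hdvd
  push_cast at hdvd
  rw [pow_mul, ZMod.pow_card, sub_eq_zero] at hdvd
  have h20 : (2 : ZMod p) ≠ 0 := by
    have : ((2 : ℕ) : ZMod p) ≠ 0 := by
      rw [Ne, ZMod.natCast_eq_zero_iff]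
      intro h2
      rw [(Nat.prime_dvd_prime_iff_eq hp Nat.prime_two).1 h2] at hp2
      exact absurd hp2 (by decide)
    exact_mod_cast this
  refine h (orderOf_dvd_of_pow_eq_one (mul_left_cancel₀ h20 ?_))
  rw [← pow_succ', Nat.sub_add_cancel hq.one_le, hdvd, mul_one]

theorem mainTheorem11 (n p₁ p₂ : ℕ) (hp₁ : p₁.Prime) (hp₂ : p₂.Prime) (hodd₁ : Odd p₁)
    (hodd₂ : Odd p₂) (hn : n = p₁ * p₂)
    (h₁₂ : ¬ orderOf (2 : ZMod p₁) ∣ p₂ - 1) (h₂₁ : ¬ orderOf (2 : ZMod p₂) ∣ p₁ - 1)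
    {E : Type*} [Fintype E] [DecidableEq E] (hE : Fintype.card E = n) :
    -- `T_n(X, 2)`, where `x = X + 1`, is the trinomial `X ^ n + (2 ^ n - 2) X ^ (n - 1) + 1`
    ((threeValuedRankedSet E).corankNullity.map (evalRingHom 2)).comp (X + 1) =
        (X ^ n + C (2 ^ n - 2) * X ^ (n - 1) + 1 : ℤ[X]) ∧
      Nonempty ((X ^ n + C (2 ^ n - 2) * X ^ (n - 1) + 1 : ℚ[X]).Gal ≃* Equiv.Perm (Fin n)) ∧
      Nonempty (galoisGroupOver ℚ (threeValuedRankedSet E).corankNullity ≃*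
        Equiv.Perm (Fin n)) := by
  have hn4 : 4 ≤ n := hn ▸ Nat.mul_le_mul hp₁.two_le hp₂.two_le
  have : Nonempty E := Fintype.card_pos_iff.1 (by lia)
  have hT := corankNullity_threeValuedRankedSet (E := E) (by lia)
  have hb := eval_two_sum_proper_nonempty (E := E)
  rw [hE] at hT hb
  set b : ℤ[X] := ∑ A ∈ (Finset.univ.erase ∅).erase (Finset.univ : Finset E), (X - 1) ^ (A.card - 1)
  have hlt : (n : ℤ) < |2 ^ n - 2| := by
    have h1 : n + 2 < 2 ^ n := by
      clear * - hn4
      induction n, hn4 using Nat.le_induction with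
      | base => decide
      | succ k hk ih => rw [pow_succ]; lia
    have h2 : (n + 2 : ℤ) < 2 ^ n := by exact_mod_cast h1
    exact lt_of_lt_of_le (by lia) (le_abs_self _)
  have hcop : IsCoprime (n : ℤ) (2 ^ n - 2) := by
    rw [hn, Nat.cast_mul]
    refine IsCoprime.mul_left ?_ ?_
    · rw [(Nat.prime_iff_prime_int.1 hp₁).coprime_iff_not_dvd]
      exact not_dvd_two_pow_mul_sub_two hp₁ hodd₁ hp₂ h₁₂
    · rw [(Nat.prime_iff_prime_int.1 hp₂).coprime_iff_not_dvd, mul_comm p₁]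
      exact not_dvd_two_pow_mul_sub_two hp₂ hodd₂ hp₁ h₂₁
  have hcard := factorial_le_card_gal_trinomial (by lia) hlt hcop
  push_cast at hcard
  have hspec : ((threeValuedRankedSet E).corankNullity.map (evalRingHom 2)).comp (X + 1) =
      (X ^ n + C (2 ^ n - 2) * X ^ (n - 1) + 1 : ℤ[X]) := by
    rw [hT]
    simp [hb]
  refine ⟨hspec, Gal.nonempty_mulEquiv_perm_of_factorial_le
    (natDegree_X_pow_add_C_mul_X_pow_add_one (by lia) _).le hcard, ?_⟩
  set F : ℚ[X][X] := (threeValuedRankedSet E).corankNullity.map (mapRingHom (Int.castRingHom ℚ))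
    with hF
  have hFcomp : F = (X ^ n + C (b.map (Int.castRingHom ℚ)) * X ^ (n - 1) + 1 : ℚ[X][X]).comp
      (X - C 1) := by
    rw [hF, hT]
    simp
  have hFm : F.Monic := by
    rw [hFcomp]
    exact (monic_X_pow_add_C_mul_X_pow_add_one (by lia) _).comp_X_sub_C 1
  have hFd : F.natDegree = n := by
    rw [hFcomp, natDegree_comp, natDegree_X_sub_C, mul_one,
      natDegree_X_pow_add_C_mul_X_pow_add_one (by lia)]
  have hF2 : F.map (evalRingHom 2) =
      (X ^ n + C (2 ^ n - 2) * X ^ (n - 1) + 1 : ℚ[X]).comp (X - C 1) := by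
    have hb2 : (b.map (Int.castRingHom ℚ)).eval 2 = 2 ^ n - 2 := by
      have := congrArg (Int.castRingHom ℚ) hb
      rw [← eval_map_apply] at this
      simpa using this
    rw [hFcomp]
    simp [hb2]
  have hle := Gal.card_map_le_card_map (K := RatFunc ℚ) (φ := evalRingHom (2 : ℚ))
    (fun c ↦ ⟨C c, by simp⟩) hFm
  rw [hF2] at hle
  -- The specialization is the trinomial in X - 1; the group of a composite polynomial surjects onto
  -- that of the outer one.
  have hle' := Nat.card_le_card_of_surjective _ (Gal.restrictComp_surjective
    (X ^ n + C (2 ^ n - 2) * X ^ (n - 1) + 1 : ℚ[X]) (X - C 1)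
      (by simp [-map_one]))
  unfold galoisGroupOver
  rw [← Polynomial.map_map, ← hF]
  exact Gal.nonempty_mulEquiv_perm_of_factorial_le (natDegree_map_le.trans hFd.le)
    (hcard.trans (hle'.trans hle))
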